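/- Let $n\ge 1$ be an integer and let $0<\alpha<n$. Write the points of $\mathbb R^{n+1}=\mathbb R^n\times\mathbb R$ as $(y,s)$, let $|y|$ be the Euclidean norm of $y\in\mathbb R^n$, and put $\Lambda=\{(y,s)\in\mathbb R^n\times\mathbb R : |s|>|y|\}$. For a (real- or complex-valued) function $f$ on $\mathbb R^{n+1}$ define $$ (I_\alpha f)(x,t)=\iint_{\Lambda} f(x-y,t-s)\left(\frac{1}{|s|+|y|}\right)^{n-\alpha}\left(\frac{1}{|s|-|y|}\right)^{1-\frac{\alpha}{n}}\,dy\,ds . $$ Let $1<p<q<\infty$. Then $I_\alpha$ is bounded from $L^p(\mathbb R^{n+1})$ to $L^q(\mathbb R^{n+1})$, that is, there is a constant $C<\infty$ such that for every $f\in L^p(\mathbb R^{n+1})$ the integral defining $(I_\alpha f)(x,t)$ converges absolutely for almost every $(x,t)$, and $$ \|I_\alpha f\|_{L^q(\mathbb R^{n+1})}\le C\,\|f\|_{L^p(\mathbb R^{n+1})}, $$ if and only if $$ \frac{\alpha}{n}=\frac1p-\frac1q . $$ -/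

import Mathlib

open MeasureTheory
open scoped NNReal ENNReal

/-- The space `ℝⁿ × ℝ = ℝⁿ⁺¹`; a point is `(y, s)`, with the Euclidean norm on `ℝⁿ`
and with Lebesgue measure (the product `volume`). -/
abbrev SpaceTime (n : ℕ) : Type := EuclideanSpace ℝ (Fin n) × ℝ

/-- The light-cone region `Λ = {(y, s) : |s| > |y|}`. -/
def coneRegion (n : ℕ) : Set (SpaceTime n) := {w | ‖w.1‖ < |w.2|}

/-- The kernel `(1 / (|s| + |y|)) ^ (n - α) * (1 / (|s| - |y|)) ^ (1 - α / n)`. It is only used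
on `coneRegion n`, where both bases are positive. -/
noncomputable def coneKernel (n : ℕ) (α : ℝ) (w : SpaceTime n) : ℝ :=
  (1 / (|w.2| + ‖w.1‖)) ^ ((n : ℝ) - α) * (1 / (|w.2| - ‖w.1‖)) ^ (1 - α / (n : ℝ))

/-- The integrand `(y, s) ↦ f (x - y, t - s) * kernel (y, s)` of the fractional integral at the
point `z = (x, t)`. -/
noncomputable def coneIntegrand {𝕜 : Type*} [RCLike 𝕜] (n : ℕ) (α : ℝ) (f : SpaceTime n → 𝕜)
    (z w : SpaceTime n) : 𝕜 :=
  f (z.1 - w.1, z.2 - w.2) * (coneKernel n α w : 𝕜)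

/-- The fractional integral `(I_α f)(x, t)`, an integral over the region `Λ`. -/
noncomputable def coneFracInt {𝕜 : Type*} [RCLike 𝕜] (n : ℕ) (α : ℝ) (f : SpaceTime n → 𝕜)
    (z : SpaceTime n) : 𝕜 :=
  ∫ w in coneRegion n, coneIntegrand n α f z w

/-- `I_α` is bounded from `L^p(ℝⁿ⁺¹)` to `L^q(ℝⁿ⁺¹)`: there is a constant `C` such that for
every `f` in `L^p` the integral defining `I_α f` converges absolutely almost everywhere, `I_α f`
is in `L^q`, and `‖I_α f‖_q ≤ C ‖f‖_p`. -/
def ConeFracIntBounded (𝕜 : Type*) [RCLike 𝕜] (n : ℕ) (α : ℝ) (p q : ℝ≥0∞) : Prop :=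
  ∃ C : ℝ≥0, ∀ f : SpaceTime n → 𝕜, MemLp f p volume →
    (∀ᵐ z : SpaceTime n, IntegrableOn (coneIntegrand n α f z) (coneRegion n) volume) ∧
    MemLp (coneFracInt n α f) q volume ∧
    eLpNorm (coneFracInt n α f) q volume ≤ C * eLpNorm f p volume

/-! Put γ = α/n and let r be the exponent conjugate to q. The condition α/n = 1/p - 1/q then reads
1/p + 1/r = 1 + γ, the Hardy–Littlewood–Sobolev relation for order γ. It does not involve the
dimension, so the same p, r serve in x and in t.

Sufficiency. On the cone, for y ≠ 0, the kernel is at most |y|^(-n(1-γ)) (|s|-|y|)^(-(1-γ))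
(`extendedConeKernel_le`). For fixed y the second factor is the fractional integration kernel on the
line with its singularity moved to ±|y|. Its level sets have measure bounded independently of the
shift, so it obeys a bilinear inequality in t uniformly in y (`exists_shiftedKernel_bilinear_le`).
What is left is the Riesz kernel in x acting on the L^p and L^r norms of the t-slices
(`exists_riesz_bilinear_le`). Duality turns the bilinear bound into the bound from L^p to L^q.

Both bilinear inequalities are cases of `lintegral_lintegral_kernel_mul_le`, which asks only that
the kernel have integral at most C |E|^γ over every measurable set E, in each variable. Weak type
1/(1-γ) supplies this.

Necessity. The kernel is homogeneous of degree -(n+1)(1-γ). Testing on indicators of balls of radius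
comparable to R bounds a power of R for all R > 0, so its exponent must vanish. -/

/-! ### Truncations, and integrals of weak-type kernels over sets. -/

theorem lintegral_Ioc_rpow {a H : ℝ} (ha : -1 < a) (hH : 0 ≤ H) :
    ∫⁻ t in Set.Ioc 0 H, ENNReal.ofReal (t ^ a) = ENNReal.ofReal (H ^ (a + 1) / (a + 1)) := by
  rw [← ofReal_integral_eq_lintegral_ofReal]
  · rw [← intervalIntegral.integral_of_le hH, integral_rpow (Or.inl ha),
      Real.zero_rpow (by linarith), sub_zero]
  · exact (intervalIntegrable_iff_integrableOn_Ioc_of_le hH).1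
      (intervalIntegral.intervalIntegrable_rpow' ha)
  · filter_upwards [self_mem_ae_restrict measurableSet_Ioc] with t ht
    exact Real.rpow_nonneg ht.1.le _

theorem lintegral_Ioi_rpow {a c : ℝ} (ha : a < -1) (hc : 0 < c) :
    ∫⁻ t in Set.Ioi c, ENNReal.ofReal (t ^ a) = ENNReal.ofReal (-c ^ (a + 1) / (a + 1)) := by
  rw [← ofReal_integral_eq_lintegral_ofReal]
  · rw [integral_Ioi_rpow_of_lt ha hc]
  · exact integrableOn_Ioi_rpow_of_lt ha hc
  · filter_upwards [self_mem_ae_restrict measurableSet_Ioi] with t ht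
    exact Real.rpow_nonneg (hc.le.trans (le_of_lt ht)) _

/-- If `ν` is controlled by the power `γ` of `μ` and `g` is in the unit ball of `L^r(μ)`, then the
`ν`-integral of the truncation of `g` at height `H` is at most a constant times `H^(1-rγ)`. -/
theorem lintegral_min_le {X : Type*} [MeasurableSpace X] {μ ν : Measure X} {g : X → ℝ≥0∞}
    (hg : Measurable g) {γ r : ℝ} (hγ : 0 < γ) (hr : 0 < r) (hrγ : r * γ < 1) {C : ℝ≥0∞}
    (hν : ∀ E, MeasurableSet E → ν E ≤ C * μ E ^ γ) (hgr : ∫⁻ x, g x ^ r ∂μ ≤ 1)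
    {H : ℝ≥0∞} (hH : H ≠ ∞) :
    ∫⁻ x, min (g x) H ∂ν ≤ C * (ENNReal.ofReal (1 / (1 - r * γ)) * H ^ (1 - r * γ)) := by
  have hfin : ∀ x, min (g x) H ≠ ∞ := fun x => ne_top_of_le_ne_top hH (min_le_right _ _)
  have h1 : ∫⁻ x, min (g x) H ∂ν = ∫⁻ x, ENNReal.ofReal (min (g x) H).toReal ∂ν := by
    simp_rw [ENNReal.ofReal_toReal (hfin _)]
  rw [h1, lintegral_eq_lintegral_meas_lt ν (ae_of_all _ fun _ => ENNReal.toReal_nonneg)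
    (hg.min measurable_const).ennreal_toReal.aemeasurable]
  -- Chebyshev: μ{g ≥ t} ≤ t^(-r), so the ν-measure is at most C t^(-rγ), which is integrable at 0
  -- because rγ < 1. Levels above H contribute nothing.
  have hb : ∀ t ∈ Set.Ioi (0 : ℝ), ν {x | t < (min (g x) H).toReal} ≤
      (Set.Ioc 0 H.toReal).indicator (fun t => C * ENNReal.ofReal (t ^ (-(r * γ)))) t := by
    intro t ht
    have ht : 0 < t := ht
    by_cases htH : t ≤ H.toReal
    · rw [Set.indicator_of_mem (show t ∈ Set.Ioc 0 H.toReal from ⟨ht, htH⟩)]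
      have hsub : {x | t < (min (g x) H).toReal} ⊆
          {x | ENNReal.ofReal (t ^ r) ≤ g x ^ r} := by
        intro x hx
        have hx : t < (min (g x) H).toReal := hx
        have h2 : ENNReal.ofReal t ≤ g x :=
          ((ENNReal.ofReal_lt_iff_lt_toReal ht.le (hfin x)).2 hx).le.trans (min_le_left _ _)
        show ENNReal.ofReal (t ^ r) ≤ g x ^ r
        rw [← ENNReal.ofReal_rpow_of_pos ht]
        exact ENNReal.rpow_le_rpow h2 hr.le
      have hμ : μ {x | ENNReal.ofReal (t ^ r) ≤ g x ^ r} ≤ ENNReal.ofReal (t ^ (-r)) := by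
        rw [Real.rpow_neg ht.le, ENNReal.ofReal_inv_of_pos (Real.rpow_pos_of_pos ht _),
          ENNReal.le_inv_iff_mul_le, mul_comm]
        exact (mul_meas_ge_le_lintegral (hg.pow_const r) _).trans hgr
      calc ν {x | t < (min (g x) H).toReal}
          ≤ ν {x | ENNReal.ofReal (t ^ r) ≤ g x ^ r} := measure_mono hsub
        _ ≤ C * μ {x | ENNReal.ofReal (t ^ r) ≤ g x ^ r} ^ γ :=
            hν _ (measurableSet_le measurable_const (hg.pow_const r))
        _ ≤ C * ENNReal.ofReal (t ^ (-r)) ^ γ := by gcongr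
        _ = C * ENNReal.ofReal (t ^ (-(r * γ))) := by
            rw [ENNReal.ofReal_rpow_of_pos (Real.rpow_pos_of_pos ht _), ← Real.rpow_mul ht.le,
              neg_mul]
    · have : {x | t < (min (g x) H).toReal} = ∅ := by
        ext x
        simp only [Set.mem_ofPred_eq, Set.mem_empty_iff_false, iff_false, not_lt]
        exact (ENNReal.toReal_mono hH (min_le_right _ _)).trans (not_le.1 htH).le
      rw [this]; simp
  calc ∫⁻ t in Set.Ioi 0, ν {x | t < (min (g x) H).toReal}
      ≤ ∫⁻ t in Set.Ioi 0, (Set.Ioc 0 H.toReal).indicator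
          (fun t => C * ENNReal.ofReal (t ^ (-(r * γ)))) t :=
        setLIntegral_mono' measurableSet_Ioi hb
    _ ≤ ∫⁻ t, (Set.Ioc 0 H.toReal).indicator
          (fun t => C * ENNReal.ofReal (t ^ (-(r * γ)))) t := setLIntegral_le_lintegral _ _
    _ = C * ENNReal.ofReal (H.toReal ^ (-(r * γ) + 1) / (-(r * γ) + 1)) := by
        rw [lintegral_indicator measurableSet_Ioc, lintegral_const_mul _ (by fun_prop),
          lintegral_Ioc_rpow (by linarith) ENNReal.toReal_nonneg]
    _ = _ := by
        have h3 : 0 < 1 - r * γ := by linarith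
        rw [show -(r * γ) + 1 = 1 - r * γ by ring, div_eq_inv_mul,
          ENNReal.ofReal_mul (by positivity), one_div,
          ← ENNReal.ofReal_rpow_of_nonneg ENNReal.toReal_nonneg h3.le, ENNReal.ofReal_toReal hH]

/-- A kernel of weak type `1 / (1 - γ)` has integral at most a constant times `μ E ^ γ` over
every set `E`. -/
theorem setLIntegral_le_of_weak_type {X : Type*} [MeasurableSpace X] {μ : Measure X} {K : X → ℝ}
    (hK : Measurable K) (hK0 : ∀ x, 0 ≤ K x) {γ A : ℝ} (hγ : 0 < γ) (hγ1 : γ < 1) (hA : 0 ≤ A)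
    (hw : ∀ t, 0 < t → μ {x | t < K x} ≤ ENNReal.ofReal (A * t ^ (-(1 / (1 - γ))))) (E : Set X) :
    ∫⁻ x in E, ENNReal.ofReal (K x) ∂μ ≤
      ENNReal.ofReal (1 + A * ((1 - γ) / γ)) * μ E ^ γ := by
  have h1γ : 0 < 1 - γ := by linarith
  have hpos : 0 < 1 + A * ((1 - γ) / γ) := by positivity
  rcases eq_or_ne (μ E) 0 with h0 | h0
  · rw [Measure.restrict_eq_zero.2 h0]; simp
  rcases eq_or_ne (μ E) ∞ with ht | ht
  · rw [ht, ENNReal.top_rpow_of_pos hγ, ENNReal.mul_top (by simpa using hpos)]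
    exact le_top
  obtain ⟨m, hm, hmE⟩ : ∃ m : ℝ, 0 < m ∧ μ E = ENNReal.ofReal m :=
    ⟨(μ E).toReal, ENNReal.toReal_pos h0 ht, (ENNReal.ofReal_toReal ht).symm⟩
  -- T is the height at which t^(-1/(1-γ)) equals m. Below T the trivial bound m is used and
  -- contributes mT = m^γ; above T the weak-type bound contributes A(1-γ)/γ · m^γ.
  set T : ℝ := m ^ (-(1 - γ)) with hT
  have hTpos : 0 < T := Real.rpow_pos_of_pos hm _
  set ρ : ℝ := 1 / (1 - γ) with hρ
  have hρ1 : 1 < ρ := by rw [hρ, lt_div_iff₀ h1γ]; linarith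
  rw [lintegral_eq_lintegral_meas_lt _ (ae_of_all _ hK0) hK.aemeasurable]
  have hb : ∀ t ∈ Set.Ioi (0 : ℝ), (μ.restrict E) {x | t < K x} ≤
      (Set.Ioc 0 T).indicator (fun _ => ENNReal.ofReal m) t +
      (Set.Ioi T).indicator (fun t => ENNReal.ofReal A * ENNReal.ofReal (t ^ (-ρ))) t := by
    intro t ht
    have ht : 0 < t := ht
    by_cases htT : t ≤ T
    · rw [Set.indicator_of_mem (show t ∈ Set.Ioc 0 T from ⟨ht, htT⟩)]
      refine le_add_right ?_
      exact (measure_mono (Set.subset_univ _)).trans_eq (by rw [Measure.restrict_apply_univ, hmE])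
    · rw [Set.indicator_of_mem (show t ∈ Set.Ioi T from not_le.1 htT), ← ENNReal.ofReal_mul hA]
      exact le_add_left ((Measure.restrict_apply_le _ _).trans (hw t ht))
  calc ∫⁻ t in Set.Ioi 0, (μ.restrict E) {x | t < K x}
      ≤ ∫⁻ t in Set.Ioi 0, ((Set.Ioc 0 T).indicator (fun _ => ENNReal.ofReal m) t +
          (Set.Ioi T).indicator (fun t => ENNReal.ofReal A * ENNReal.ofReal (t ^ (-ρ))) t) :=
        setLIntegral_mono' measurableSet_Ioi hb
    _ ≤ ∫⁻ t, ((Set.Ioc 0 T).indicator (fun _ => ENNReal.ofReal m) t +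
          (Set.Ioi T).indicator (fun t => ENNReal.ofReal A * ENNReal.ofReal (t ^ (-ρ))) t) :=
        setLIntegral_le_lintegral _ _
    _ = ENNReal.ofReal m * ENNReal.ofReal T +
          ENNReal.ofReal A * ENNReal.ofReal (-T ^ (-ρ + 1) / (-ρ + 1)) := by
        rw [lintegral_add_left (measurable_const.indicator measurableSet_Ioc),
          lintegral_indicator measurableSet_Ioc, lintegral_indicator measurableSet_Ioi,
          lintegral_const_mul _ (by fun_prop), lintegral_Ioi_rpow (by linarith) hTpos]
        simp
    _ = _ := by
        have e1 : m * T = m ^ γ := by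
          rw [hT, show γ = 1 + -(1 - γ) by ring, Real.rpow_add hm, Real.rpow_one]
          ring_nf
        have e2 : T ^ (-ρ + 1) = m ^ γ := by
          rw [hT, ← Real.rpow_mul hm.le]
          congr 1
          rw [hρ]; field_simp; ring
        have e3 : -T ^ (-ρ + 1) / (-ρ + 1) = (1 - γ) / γ * m ^ γ := by
          rw [e2, show -ρ + 1 = -(γ / (1 - γ)) by rw [hρ]; field_simp; ring]
          field_simp
        have hmγ : 0 < m ^ γ := Real.rpow_pos_of_pos hm _
        rw [e3, ← ENNReal.ofReal_mul hm.le, e1, ← ENNReal.ofReal_mul hA, hmE,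
          ENNReal.ofReal_rpow_of_pos hm, ← ENNReal.ofReal_add hmγ.le (by positivity),
          ← ENNReal.ofReal_mul hpos.le]
        congr 1; ring

/-! ### The Riesz kernel and the shifted one-dimensional kernel. -/

/-- The Riesz kernel of homogeneity `-d (1 - γ)` on a space of dimension `d`. -/
theorem exists_setLIntegral_norm_sub_rpow_le {V : Type*} [NormedAddCommGroup V] [NormedSpace ℝ V]
    [MeasurableSpace V] [BorelSpace V] [FiniteDimensional ℝ V] (μ : Measure V)
    [μ.IsAddHaarMeasure] (hd : 0 < Module.finrank ℝ V) {γ : ℝ} (hγ : 0 < γ) (hγ1 : γ < 1) :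
    ∃ A : ℝ≥0, ∀ (a : V) (E : Set V),
      ∫⁻ x in E, ENNReal.ofReal (‖x - a‖ ^ (-(Module.finrank ℝ V * (1 - γ)))) ∂μ ≤
        A * μ E ^ γ := by
  set d := Module.finrank ℝ V
  have hd' : (0 : ℝ) < d := by exact_mod_cast hd
  have h1γ : 0 < 1 - γ := by linarith
  have hl : 0 < d * (1 - γ) := by positivity
  refine ⟨_, fun a E => setLIntegral_le_of_weak_type (A := (μ (Metric.ball 0 1)).toReal)
    (by fun_prop) (fun x => by positivity) hγ hγ1 ENNReal.toReal_nonneg (fun t ht => ?_) E⟩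
  have hR : 0 < t ^ (-(1 / (d * (1 - γ)))) := Real.rpow_pos_of_pos ht _
  have hsub : {x | t < ‖x - a‖ ^ (-(d * (1 - γ)))} ⊆
      Metric.ball a (t ^ (-(1 / (d * (1 - γ))))) := by
    intro x hx
    have hx : t < ‖x - a‖ ^ (-(d * (1 - γ))) := hx
    rw [mem_ball_iff_norm]
    rcases (norm_nonneg (x - a)).eq_or_lt with h | h
    · rwa [← h]
    by_contra hc
    have := Real.rpow_le_rpow_of_nonpos hR (not_lt.1 hc) (neg_nonpos.2 hl.le)
    rw [← Real.rpow_mul ht.le, show -(1 / (d * (1 - γ))) * -(d * (1 - γ)) = 1 by field_simp,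
      Real.rpow_one] at this
    linarith
  refine (measure_mono hsub).trans (le_of_eq ?_)
  rw [Measure.addHaar_ball_of_pos μ a hR, mul_comm, ENNReal.ofReal_mul ENNReal.toReal_nonneg,
    ENNReal.ofReal_toReal measure_ball_lt_top.ne, ← Real.rpow_natCast, ← Real.rpow_mul ht.le]
  congr 3
  change -(1 / (d * (1 - γ))) * (d : ℝ) = _
  field_simp

/-- The one-dimensional fractional integration kernel with its singularity moved to `±ρ`. -/
noncomputable def shiftedKernel (γ ρ s : ℝ) : ℝ := if ρ < |s| then (|s| - ρ) ^ (-(1 - γ)) else 0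

theorem measurable_shiftedKernel (γ : ℝ) :
    Measurable fun u : ℝ × ℝ => shiftedKernel γ u.1 u.2 :=
  Measurable.ite (measurableSet_lt measurable_fst (by fun_prop)) (by fun_prop) measurable_const

theorem shiftedKernel_nonneg (γ ρ s : ℝ) : 0 ≤ shiftedKernel γ ρ s := by
  unfold shiftedKernel
  split_ifs with h
  · exact Real.rpow_nonneg (sub_pos.2 h).le _
  · exact le_rfl

theorem shiftedKernel_sub_comm (γ ρ s t : ℝ) :
    shiftedKernel γ ρ (s - t) = shiftedKernel γ ρ (t - s) := by
  simp only [shiftedKernel, abs_sub_comm]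

/-- A level set lies in two intervals of length h = t^(-1/(1-γ)), next to a + ρ and a - ρ, so its
measure is at most 2h whatever ρ is. This uniformity in ρ is what later allows ρ = ‖x - x'‖. -/
theorem exists_setLIntegral_shiftedKernel_le {γ : ℝ} (hγ : 0 < γ) (hγ1 : γ < 1) :
    ∃ A : ℝ≥0, ∀ (ρ a : ℝ) (E : Set ℝ),
      ∫⁻ s in E, ENNReal.ofReal (shiftedKernel γ ρ (s - a)) ≤ A * volume E ^ γ := by
  have h1γ : 0 < 1 - γ := by linarith
  refine ⟨_, fun ρ a E => setLIntegral_le_of_weak_type (A := 2)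
    ((measurable_shiftedKernel γ).comp (measurable_const.prodMk (by fun_prop)))
    (fun x => shiftedKernel_nonneg _ _ _) hγ hγ1 two_pos.le (fun t ht => ?_) E⟩
  set h := t ^ (-(1 / (1 - γ)))
  have hh : 0 < h := Real.rpow_pos_of_pos ht _
  have hsub : {s | t < shiftedKernel γ ρ (s - a)} ⊆
      Set.Icc (a + ρ) (a + ρ + h) ∪ Set.Icc (a - ρ - h) (a - ρ) := by
    intro s hs
    have hs : t < shiftedKernel γ ρ (s - a) := hs
    unfold shiftedKernel at hs
    split_ifs at hs with hρ
    · have h1 : |s - a| - ρ < h := by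
        by_contra hc
        have := Real.rpow_le_rpow_of_nonpos hh (not_lt.1 hc) (neg_nonpos.2 h1γ.le)
        rw [← Real.rpow_mul ht.le, show -(1 / (1 - γ)) * -(1 - γ) = 1 by field_simp,
          Real.rpow_one] at this
        linarith
      rcases abs_cases (s - a) with ⟨h2, _⟩ | ⟨h2, _⟩
      · left; constructor <;> linarith
      · right; constructor <;> linarith
    · linarith
  refine (measure_mono hsub).trans ((measure_union_le _ _).trans (le_of_eq ?_))
  rw [Real.volume_Icc, Real.volume_Icc, ← ENNReal.ofReal_add (by linarith) (by linarith)]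
  congr 1; ring

/-! ### The bilinear Hardy–Littlewood–Sobolev inequality. -/

section Bilinear

variable {X Y : Type*} [MeasurableSpace X] [MeasurableSpace Y] {μ : Measure X} {ν : Measure Y}
  {K : X → Y → ℝ≥0∞} {f : Y → ℝ≥0∞} {g : X → ℝ≥0∞} {C : ℝ≥0∞} {p r γ : ℝ}

/-- For fixed y, `lintegral_min_le` applies to the measure K(·, y) dμ with height H = f(y)^(p/r).
Since (p/r)(1 - rγ) = p - 1, the outcome f(y) H^(1-rγ) is exactly f(y)^p. -/
theorem lintegral_lintegral_mul_min_le (hK : Measurable (Function.uncurry K))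
    (hKE : ∀ y E, MeasurableSet E → ∫⁻ x in E, K x y ∂μ ≤ C * μ E ^ γ)
    (hf : Measurable f) (hg : Measurable g) (hγ : 0 < γ) (hp : 1 < p) (hr : 1 < r)
    (hpr : 1 / p + 1 / r = 1 + γ)
    (hfp : ∫⁻ y, f y ^ p ∂ν ≤ 1) (hgr : ∫⁻ x, g x ^ r ∂μ ≤ 1) :
    ∫⁻ y, ∫⁻ x, K x y * (f y * min (g x) (f y ^ (p / r))) ∂μ ∂ν ≤
      C * ENNReal.ofReal (1 / (1 - r * γ)) := by
  have hp0 : 0 < p := by linarith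
  have hr0 : 0 < r := by linarith
  have hγe : γ = 1 / p + 1 / r - 1 := by linarith
  have hrγ : r * γ = 1 - r * (1 - 1 / p) := by rw [hγe]; field_simp; ring
  have h1p : 0 < 1 - 1 / p := by
    have : 1 / p < 1 := by rw [div_lt_one hp0]; exact hp
    linarith
  have hlt : r * γ < 1 := by rw [hrγ]; nlinarith [mul_pos hr0 h1p]
  have hexp : p / r * (1 - r * γ) = p - 1 := by rw [hrγ]; field_simp; ring
  have hfin : ∀ᵐ y ∂ν, f y < ∞ := by
    filter_upwards [ae_lt_top (hf.pow_const p) (hfp.trans_lt ENNReal.one_lt_top).ne] with y hy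
    exact (ENNReal.rpow_lt_top_iff_of_pos hp0).1 hy
  calc ∫⁻ y, ∫⁻ x, K x y * (f y * min (g x) (f y ^ (p / r))) ∂μ ∂ν
      ≤ ∫⁻ y, C * ENNReal.ofReal (1 / (1 - r * γ)) * f y ^ p ∂ν := by
        refine lintegral_mono_ae ?_
        filter_upwards [hfin] with y hy
        have hKy : Measurable fun x => K x y := hK.comp (measurable_id.prodMk measurable_const)
        have hH : f y ^ (p / r) ≠ ∞ := ENNReal.rpow_ne_top_of_nonneg (by positivity) hy.ne
        have := lintegral_min_le (ν := μ.withDensity fun x => K x y) hg hγ hr0 hlt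
          (fun E hE => by rw [withDensity_apply _ hE]; exact hKE y E hE) hgr hH
        rw [lintegral_withDensity_eq_lintegral_mul _ hKy (hg.min measurable_const)] at this
        calc ∫⁻ x, K x y * (f y * min (g x) (f y ^ (p / r))) ∂μ
            = ∫⁻ x, f y * (K x y * min (g x) (f y ^ (p / r))) ∂μ := by
              congr 1; ext x; ring
          _ = f y * ∫⁻ x, K x y * min (g x) (f y ^ (p / r)) ∂μ :=
              lintegral_const_mul _ (hKy.mul (hg.min measurable_const))
          _ ≤ f y * (C * (ENNReal.ofReal (1 / (1 - r * γ)) *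
                (f y ^ (p / r)) ^ (1 - r * γ))) := by gcongr; exact this
          _ = C * ENNReal.ofReal (1 / (1 - r * γ)) * (f y ^ (1 : ℝ) * f y ^ (p - 1)) := by
              rw [← ENNReal.rpow_mul, hexp, ENNReal.rpow_one]; ring
          _ = _ := by
              rw [← ENNReal.rpow_add_of_nonneg _ _ zero_le_one (by linarith)]
              congr 2; ring
    _ = C * ENNReal.ofReal (1 / (1 - r * γ)) * ∫⁻ y, f y ^ p ∂ν :=
        lintegral_const_mul _ (hf.pow_const p)
    _ ≤ _ := mul_le_of_le_one_right' hfp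

/-- At each point either g ≤ f^(p/r) or f ≤ g^(r/p), so f g is at most the sum of two truncated
products. These are exchanged by swapping the roles of (f, p) and (g, r). -/
theorem lintegral_lintegral_kernel_mul_le_of_le_one [SFinite μ] [SFinite ν]
    (hK : Measurable (Function.uncurry K))
    (hKX : ∀ y E, MeasurableSet E → ∫⁻ x in E, K x y ∂μ ≤ C * μ E ^ γ)
    (hKY : ∀ x E, MeasurableSet E → ∫⁻ y in E, K x y ∂ν ≤ C * ν E ^ γ)
    (hf : Measurable f) (hg : Measurable g) (hγ : 0 < γ) (hp : 1 < p) (hr : 1 < r)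
    (hpr : 1 / p + 1 / r = 1 + γ)
    (hfp : ∫⁻ y, f y ^ p ∂ν ≤ 1) (hgr : ∫⁻ x, g x ^ r ∂μ ≤ 1) :
    ∫⁻ x, ∫⁻ y, K x y * (f y * g x) ∂ν ∂μ ≤
      C * (ENNReal.ofReal (1 / (1 - r * γ)) + ENNReal.ofReal (1 / (1 - p * γ))) := by
  have hp0 : 0 < p := by linarith
  have hr0 : 0 < r := by linarith
  have hf' : Measurable fun z : X × Y => f z.2 := hf.comp measurable_snd
  have hg' : Measurable fun z : X × Y => g z.1 := hg.comp measurable_fst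
  have hm1 : Measurable fun z : X × Y => K z.1 z.2 * (f z.2 * min (g z.1) (f z.2 ^ (p / r))) :=
    hK.mul (hf'.mul (hg'.min (hf'.pow_const _)))
  have hpt : ∀ x y, K x y * (f y * g x) ≤ K x y * (f y * min (g x) (f y ^ (p / r))) +
      K x y * (g x * min (f y) (g x ^ (r / p))) := by
    intro x y
    rcases le_total (g x) (f y ^ (p / r)) with h | h
    · rw [min_eq_left h]; exact le_self_add
    · have h2 : f y ≤ g x ^ (r / p) := by
        have := ENNReal.rpow_le_rpow h (z := r / p) (by positivity)
        rwa [← ENNReal.rpow_mul, show p / r * (r / p) = 1 by field_simp,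
          ENNReal.rpow_one] at this
      rw [min_eq_left h2, mul_comm (g x)]; exact le_add_self
  calc ∫⁻ x, ∫⁻ y, K x y * (f y * g x) ∂ν ∂μ
      ≤ ∫⁻ x, ∫⁻ y, (K x y * (f y * min (g x) (f y ^ (p / r))) +
          K x y * (g x * min (f y) (g x ^ (r / p)))) ∂ν ∂μ :=
        lintegral_mono fun x => lintegral_mono fun y => hpt x y
    _ = ∫⁻ x, ∫⁻ y, K x y * (f y * min (g x) (f y ^ (p / r))) ∂ν ∂μ +
          ∫⁻ x, ∫⁻ y, K x y * (g x * min (f y) (g x ^ (r / p))) ∂ν ∂μ := by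
        rw [← lintegral_add_left hm1.lintegral_prod_right']
        refine lintegral_congr fun x => ?_
        exact lintegral_add_left (hm1.comp measurable_prodMk_left) _
    _ ≤ C * ENNReal.ofReal (1 / (1 - r * γ)) + C * ENNReal.ofReal (1 / (1 - p * γ)) := by
        gcongr
        · rw [lintegral_lintegral_swap hm1.aemeasurable]
          exact lintegral_lintegral_mul_min_le hK hKX hf hg hγ hp hr hpr hfp hgr
        · exact lintegral_lintegral_mul_min_le (K := fun y x => K x y)
            (hK.comp measurable_swap) hKY hg hf hγ hr hp (by linarith) hgr hfp
    _ = _ := by ring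

/-- The bilinear Hardy–Littlewood–Sobolev inequality for a kernel whose integral over every set
is controlled by the power `γ` of the measure, in both variables. -/
theorem lintegral_lintegral_kernel_mul_le [SFinite μ] [SFinite ν]
    (hK : Measurable (Function.uncurry K))
    (hKX : ∀ y E, MeasurableSet E → ∫⁻ x in E, K x y ∂μ ≤ C * μ E ^ γ)
    (hKY : ∀ x E, MeasurableSet E → ∫⁻ y in E, K x y ∂ν ≤ C * ν E ^ γ) (hC : C ≠ 0)
    (hf : Measurable f) (hg : Measurable g) (hγ : 0 < γ) (hp : 1 < p) (hr : 1 < r)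
    (hpr : 1 / p + 1 / r = 1 + γ) :
    ∫⁻ x, ∫⁻ y, K x y * (f y * g x) ∂ν ∂μ ≤
      C * (ENNReal.ofReal (1 / (1 - r * γ)) + ENNReal.ofReal (1 / (1 - p * γ))) *
        ((∫⁻ y, f y ^ p ∂ν) ^ (1 / p) * (∫⁻ x, g x ^ r ∂μ) ^ (1 / r)) := by
  have hp0 : 0 < p := by linarith
  have hr0 : 0 < r := by linarith
  -- A nonzero constant makes the right-hand side infinite when one norm is infinite and the other
  -- nonzero; otherwise 0 · ∞ = 0 would spoil the bound.
  have hD : ENNReal.ofReal (1 / (1 - r * γ)) + ENNReal.ofReal (1 / (1 - p * γ)) ≠ 0 := by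
    have hγe : γ = 1 / p + 1 / r - 1 := by linarith
    have hrγ : 1 - r * γ = r * (1 - 1 / p) := by rw [hγe]; field_simp; ring
    have h1p : 0 < 1 - 1 / p := by
      have : 1 / p < 1 := by rw [div_lt_one hp0]; exact hp
      linarith
    have : 0 < 1 / (1 - r * γ) := by rw [hrγ]; positivity
    simp only [ne_eq, add_eq_zero, not_and_or]
    exact Or.inl (by simpa using this)
  set D := ENNReal.ofReal (1 / (1 - r * γ)) + ENNReal.ofReal (1 / (1 - p * γ)) with hDdef
  set F := (∫⁻ y, f y ^ p ∂ν) ^ (1 / p) with hF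
  set G := (∫⁻ x, g x ^ r ∂μ) ^ (1 / r) with hG
  rcases eq_or_ne F 0 with hF0 | hF0
  · have h0 : ∫⁻ y, f y ^ p ∂ν = 0 := by
      rwa [hF, ENNReal.rpow_eq_zero_iff_of_pos (by positivity)] at hF0
    rw [lintegral_eq_zero_iff (hf.pow_const p)] at h0
    have : ∀ x, ∫⁻ y, K x y * (f y * g x) ∂ν = 0 := by
      intro x
      rw [← lintegral_zero (μ := ν)]
      refine lintegral_congr_ae ?_
      filter_upwards [h0] with y hy
      rw [Pi.zero_apply, ENNReal.rpow_eq_zero_iff_of_pos hp0] at hy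
      simp [hy]
    simp [this]
  rcases eq_or_ne G 0 with hG0 | hG0
  · have h0 : ∫⁻ x, g x ^ r ∂μ = 0 := by
      rwa [hG, ENNReal.rpow_eq_zero_iff_of_pos (by positivity)] at hG0
    rw [lintegral_eq_zero_iff (hg.pow_const r)] at h0
    have : ∫⁻ x, ∫⁻ y, K x y * (f y * g x) ∂ν ∂μ = 0 := by
      rw [← lintegral_zero (μ := μ)]
      refine lintegral_congr_ae ?_
      filter_upwards [h0] with x hx
      rw [Pi.zero_apply, ENNReal.rpow_eq_zero_iff_of_pos hr0] at hx
      simp [hx]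
    simp [this]
  rcases eq_or_ne F ∞ with hFt | hFt
  · rw [hFt, ENNReal.top_mul hG0, ENNReal.mul_top (mul_ne_zero hC hD)]; exact le_top
  rcases eq_or_ne G ∞ with hGt | hGt
  · rw [hGt, ENNReal.mul_top hF0, ENNReal.mul_top (mul_ne_zero hC hD)]; exact le_top
  have hFp : ∫⁻ y, f y ^ p ∂ν = F ^ p := by
    rw [hF, ← ENNReal.rpow_mul, one_div_mul_cancel hp0.ne', ENNReal.rpow_one]
  have hGr : ∫⁻ x, g x ^ r ∂μ = G ^ r := by
    rw [hG, ← ENNReal.rpow_mul, one_div_mul_cancel hr0.ne', ENNReal.rpow_one]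
  have hf1 : ∫⁻ y, (F⁻¹ * f y) ^ p ∂ν ≤ 1 := by
    simp_rw [ENNReal.mul_rpow_of_nonneg _ _ hp0.le]
    rw [lintegral_const_mul _ (hf.pow_const p), hFp, ← ENNReal.mul_rpow_of_nonneg _ _ hp0.le,
      ENNReal.inv_mul_cancel hF0 hFt, ENNReal.one_rpow]
  have hg1 : ∫⁻ x, (G⁻¹ * g x) ^ r ∂μ ≤ 1 := by
    simp_rw [ENNReal.mul_rpow_of_nonneg _ _ hr0.le]
    rw [lintegral_const_mul _ (hg.pow_const r), hGr, ← ENNReal.mul_rpow_of_nonneg _ _ hr0.le,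
      ENNReal.inv_mul_cancel hG0 hGt, ENNReal.one_rpow]
  have key := lintegral_lintegral_kernel_mul_le_of_le_one hK hKX hKY (hf.const_mul F⁻¹)
    (hg.const_mul G⁻¹) hγ hp hr hpr hf1 hg1
  have hm : Measurable fun z : X × Y => K z.1 z.2 * (F⁻¹ * f z.2 * (G⁻¹ * g z.1)) :=
    hK.mul (((hf.comp measurable_snd).const_mul _).mul ((hg.comp measurable_fst).const_mul _))
  have hFG : F * G * (F⁻¹ * G⁻¹) = 1 := by
    rw [show F * G * (F⁻¹ * G⁻¹) = F⁻¹ * F * (G⁻¹ * G) by ring,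
      ENNReal.inv_mul_cancel hF0 hFt, ENNReal.inv_mul_cancel hG0 hGt, one_mul]
  calc ∫⁻ x, ∫⁻ y, K x y * (f y * g x) ∂ν ∂μ
      = ∫⁻ x, ∫⁻ y, F * G * (K x y * (F⁻¹ * f y * (G⁻¹ * g x))) ∂ν ∂μ := by
        refine lintegral_congr fun x => lintegral_congr fun y => ?_
        rw [show F * G * (K x y * (F⁻¹ * f y * (G⁻¹ * g x))) =
          F * G * (F⁻¹ * G⁻¹) * (K x y * (f y * g x)) by ring, hFG, one_mul]
    _ = F * G * ∫⁻ x, ∫⁻ y, K x y * (F⁻¹ * f y * (G⁻¹ * g x)) ∂ν ∂μ := by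
        rw [← lintegral_const_mul _ hm.lintegral_prod_right']
        refine lintegral_congr fun x => ?_
        exact lintegral_const_mul _ (hm.comp measurable_prodMk_left)
    _ ≤ F * G * (C * D) := by gcongr
    _ = _ := by ring

end Bilinear

/-! ### Duality. -/

/-- The converse of Hölder's inequality. -/
theorem lintegral_rpow_le_of_forall_lintegral_mul_le {Z : Type*} [MeasurableSpace Z]
    {μ : Measure Z} [SigmaFinite μ] {T : Z → ℝ≥0∞} (hT : Measurable T) {q r : ℝ}
    (hqr : q.HolderConjugate r) {A : ℝ≥0∞}
    (h : ∀ g : Z → ℝ≥0∞, Measurable g → ∫⁻ z, T z * g z ∂μ ≤ A * (∫⁻ z, g z ^ r ∂μ) ^ (1 / r)) :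
    (∫⁻ z, T z ^ q ∂μ) ^ (1 / q) ≤ A := by
  have hq0 := hqr.pos
  have hr0 := hqr.symm.pos
  have hq1 := hqr.sub_one_pos
  -- Bounded truncations supported on sets of finite measure have a finite q-th power integral J, so
  -- a power of J can be cancelled below.
  set S : ℕ → Z → ℝ≥0∞ := fun N => (spanningSets μ N).indicator fun z => min (T z) N with hS
  have hSm : ∀ N, Measurable (S N) := fun N =>
    (hT.min measurable_const).indicator (measurableSet_spanningSets μ N)
  have hST : ∀ N z, S N z ≤ T z := fun N z =>
    (Set.indicator_le_self _ _ z).trans (min_le_left _ _)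
  have hmono : Monotone S := by
    intro M N hMN z
    by_cases hz : z ∈ spanningSets μ M
    · simp only [hS, Set.indicator_of_mem hz,
        Set.indicator_of_mem (monotone_spanningSets μ hMN hz)]
      gcongr
    · simp [hS, Set.indicator_of_notMem hz]
  have hsup : ∀ z, ⨆ N, S N z = T z := by
    intro z
    refine le_antisymm (iSup_le fun N => hST N z) (le_of_forall_lt fun a ha => ?_)
    obtain ⟨M, hM⟩ := ENNReal.exists_nat_gt (ha.trans_le le_top).ne
    have hz : z ∈ spanningSets μ (max M (spanningSetsIndex μ z)) :=
      monotone_spanningSets μ (le_max_right _ _) (mem_spanningSetsIndex μ z)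
    refine lt_of_lt_of_le ?_ (le_iSup _ (max M (spanningSetsIndex μ z)))
    simp only [hS, Set.indicator_of_mem hz]
    exact lt_min ha (hM.trans_le (by exact_mod_cast le_max_left _ _))
  have hbd : ∀ N, ∫⁻ z, S N z ^ q ∂μ ≤ A ^ q := by
    intro N
    set J := ∫⁻ z, S N z ^ q ∂μ with hJ
    have hJt : J ≠ ∞ := by
      have : J ≤ ∫⁻ z in spanningSets μ N, (N : ℝ≥0∞) ^ q ∂μ := by
        rw [← lintegral_indicator (measurableSet_spanningSets μ N)]
        refine lintegral_mono fun z => ?_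
        by_cases hz : z ∈ spanningSets μ N
        · simp only [hS, Set.indicator_of_mem hz]
          exact ENNReal.rpow_le_rpow (min_le_right _ _) hq0.le
        · simp [hS, Set.indicator_of_notMem hz, hq0]
      refine ne_top_of_le_ne_top ?_ this
      rw [setLIntegral_const]
      exact ENNReal.mul_ne_top (ENNReal.rpow_ne_top_of_nonneg hq0.le (by simp))
        (measure_spanningSets_lt_top μ N).ne
    rcases eq_or_ne J 0 with hJ0 | hJ0
    · rw [hJ0]; exact zero_le
    -- The extremal test function of Hölder's inequality, S^(q-1), whose r-th power is S^q.
    have h1 : J ≤ A * J ^ (1 / r) := by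
      calc J ≤ ∫⁻ z, T z * S N z ^ (q - 1) ∂μ := by
            refine lintegral_mono fun z => ?_
            calc S N z ^ q = S N z ^ (1 : ℝ) * S N z ^ (q - 1) := by
                  rw [← ENNReal.rpow_add_of_nonneg _ _ zero_le_one hq1.le]; congr 1; ring
              _ ≤ T z * S N z ^ (q - 1) := by
                  rw [ENNReal.rpow_one]; gcongr; exact hST N z
        _ ≤ A * (∫⁻ z, (S N z ^ (q - 1)) ^ r ∂μ) ^ (1 / r) := h _ ((hSm N).pow_const _)
        _ = A * J ^ (1 / r) := by
            simp_rw [← ENNReal.rpow_mul, hqr.sub_one_mul_conj, hJ]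
    have h2 : J ^ (1 / q) ≤ A := by
      have h3 : J = J ^ (1 / q) * J ^ (1 / r) := by
        rw [← ENNReal.rpow_add_of_nonneg _ _ (by positivity) (by positivity), one_div, one_div,
          hqr.inv_add_inv_eq_one, ENNReal.rpow_one]
      have h4 : J ^ (1 / r) ≠ 0 := by
        rw [ne_eq, ENNReal.rpow_eq_zero_iff_of_pos (by positivity)]; exact hJ0
      have h5 : J ^ (1 / r) ≠ ∞ := ENNReal.rpow_ne_top_of_nonneg (by positivity) hJt
      exact (ENNReal.mul_le_mul_iff_left h4 h5).1 (h3.symm.le.trans h1)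
    calc J = (J ^ (1 / q)) ^ q := by
          rw [← ENNReal.rpow_mul, one_div_mul_cancel hq0.ne', ENNReal.rpow_one]
      _ ≤ A ^ q := ENNReal.rpow_le_rpow h2 hq0.le
  have hlim : ∫⁻ z, T z ^ q ∂μ ≤ A ^ q := by
    have hpow : ∀ z, T z ^ q = ⨆ N, S N z ^ q := by
      intro z
      rw [← hsup z]
      exact (ENNReal.orderIsoRpow q hq0).map_iSup _
    simp_rw [hpow]
    rw [lintegral_iSup (fun N => (hSm N).pow_const q)
      (fun M N hMN z => ENNReal.rpow_le_rpow (hmono hMN z) hq0.le)]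
    exact iSup_le hbd
  calc (∫⁻ z, T z ^ q ∂μ) ^ (1 / q) ≤ (A ^ q) ^ (1 / q) :=
        ENNReal.rpow_le_rpow hlim (by positivity)
    _ = A := by rw [← ENNReal.rpow_mul, mul_one_div_cancel hq0.ne', ENNReal.rpow_one]

/-! ### The cone kernel: product domination and the bound on nonnegative functions. -/

section Cone

variable {n : ℕ} {α γ p q r : ℝ}

theorem isAddHaarMeasure_volume_spaceTime (n : ℕ) :
    (volume : Measure (SpaceTime n)).IsAddHaarMeasure := by
  rw [Measure.volume_eq_prod]; infer_instance

theorem isOpen_coneRegion (n : ℕ) : IsOpen (coneRegion n) :=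
  isOpen_lt (by fun_prop) (by fun_prop)

theorem measurable_coneKernel (n : ℕ) (α : ℝ) : Measurable (coneKernel n α) := by
  unfold coneKernel; fun_prop

theorem coneKernel_nonneg {w : SpaceTime n} (hw : w ∈ coneRegion n) : 0 ≤ coneKernel n α w := by
  have h : ‖w.1‖ < |w.2| := hw
  have : 0 < |w.2| - ‖w.1‖ := sub_pos.2 h
  unfold coneKernel
  positivity

/-- The kernel extended by zero outside the cone, with values in `ℝ≥0∞`. -/
noncomputable def extendedConeKernel (n : ℕ) (α : ℝ) : SpaceTime n → ℝ≥0∞ :=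
  (coneRegion n).indicator fun w => ENNReal.ofReal (coneKernel n α w)

theorem measurable_extendedConeKernel (n : ℕ) (α : ℝ) : Measurable (extendedConeKernel n α) :=
  (measurable_coneKernel n α).ennreal_ofReal.indicator (isOpen_coneRegion n).measurableSet

/-- Dropping |s| from |s| + |y| only enlarges the first factor, since n - α > 0. The case y = 0 is
excluded because the real power of 0 with negative exponent is 0 by convention, and the bound would
fail there. -/
theorem extendedConeKernel_le (hn : 0 < n) (hαn : α < n) {w : SpaceTime n} (hw : w.1 ≠ 0) :
    extendedConeKernel n α w ≤ ENNReal.ofReal (‖w.1‖ ^ (-((n : ℝ) * (1 - α / n)))) *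
      ENNReal.ofReal (shiftedKernel (α / n) ‖w.1‖ w.2) := by
  have hn' : (0 : ℝ) < n := by exact_mod_cast hn
  by_cases h : w ∈ coneRegion n
  · have h' : ‖w.1‖ < |w.2| := h
    have hy : 0 < ‖w.1‖ := norm_pos_iff.2 hw
    have hpos : 0 < |w.2| - ‖w.1‖ := sub_pos.2 h'
    rw [extendedConeKernel, Set.indicator_of_mem h, ← ENNReal.ofReal_mul (by positivity)]
    refine ENNReal.ofReal_le_ofReal ?_
    rw [coneKernel, shiftedKernel, if_pos h', one_div, one_div, Real.inv_rpow (by positivity),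
      Real.inv_rpow hpos.le, ← Real.rpow_neg (by positivity), ← Real.rpow_neg hpos.le,
      show (n : ℝ) * (1 - α / n) = n - α by field_simp]
    refine mul_le_mul_of_nonneg_right ?_ (by positivity)
    exact Real.rpow_le_rpow_of_nonpos hy (by linarith [abs_nonneg w.2]) (by linarith)
  · rw [extendedConeKernel, Set.indicator_of_notMem h]; exact zero_le

theorem exists_shiftedKernel_bilinear_le (hγ : 0 < γ) (hγ1 : γ < 1) (hp : 1 < p) (hr : 1 < r)
    (hpr : 1 / p + 1 / r = 1 + γ) :
    ∃ B : ℝ≥0, ∀ (ρ : ℝ) (f g : ℝ → ℝ≥0∞), Measurable f → Measurable g →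
      ∫⁻ t, ∫⁻ t', ENNReal.ofReal (shiftedKernel γ ρ (t - t')) * (f t' * g t) ≤
        B * ((∫⁻ t, f t ^ p) ^ (1 / p) * (∫⁻ t, g t ^ r) ^ (1 / r)) := by
  obtain ⟨A, hA⟩ := exists_setLIntegral_shiftedKernel_le hγ hγ1
  -- Passing to A + 1 secures the nonzero constant that the bilinear inequality requires.
  have hA' : ∀ (ρ a : ℝ) (E : Set ℝ),
      ∫⁻ s in E, ENNReal.ofReal (shiftedKernel γ ρ (s - a)) ≤ ((A + 1 : ℝ≥0) : ℝ≥0∞) *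
        volume E ^ γ := fun ρ a E => (hA ρ a E).trans (by gcongr; simp)
  refine ⟨(A + 1) * (Real.toNNReal (1 / (1 - r * γ)) + Real.toNNReal (1 / (1 - p * γ))),
    fun ρ f g hf hg => ?_⟩
  have := lintegral_lintegral_kernel_mul_le (μ := volume) (ν := volume)
    (K := fun t t' => ENNReal.ofReal (shiftedKernel γ ρ (t - t')))
    (((measurable_shiftedKernel γ).comp
      (measurable_const.prodMk (measurable_fst.sub measurable_snd))).ennreal_ofReal)
    (fun a E _ => hA' ρ a E)
    (fun a E _ => by simp_rw [shiftedKernel_sub_comm γ ρ a]; exact hA' ρ a E)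
    (by simp) hf hg hγ hp hr hpr
  simpa [ENNReal.ofReal] using this

theorem exists_riesz_bilinear_le (hn : 0 < n) (hγ : 0 < γ) (hγ1 : γ < 1) (hp : 1 < p) (hr : 1 < r)
    (hpr : 1 / p + 1 / r = 1 + γ) :
    ∃ B : ℝ≥0, ∀ (f g : EuclideanSpace ℝ (Fin n) → ℝ≥0∞), Measurable f → Measurable g →
      ∫⁻ x, ∫⁻ x', ENNReal.ofReal (‖x - x'‖ ^ (-((n : ℝ) * (1 - γ)))) * (f x' * g x) ≤
        B * ((∫⁻ x, f x ^ p) ^ (1 / p) * (∫⁻ x, g x ^ r) ^ (1 / r)) := by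
  obtain ⟨A, hA⟩ := exists_setLIntegral_norm_sub_rpow_le
    (volume : Measure (EuclideanSpace ℝ (Fin n))) (by simpa using hn) hγ hγ1
  simp only [finrank_euclideanSpace, Fintype.card_fin] at hA
  have hA' : ∀ (a : EuclideanSpace ℝ (Fin n)) (E : Set (EuclideanSpace ℝ (Fin n))),
      ∫⁻ x in E, ENNReal.ofReal (‖x - a‖ ^ (-((n : ℝ) * (1 - γ)))) ≤
        ((A + 1 : ℝ≥0) : ℝ≥0∞) * volume E ^ γ := fun a E => (hA a E).trans (by gcongr; simp)
  refine ⟨(A + 1) * (Real.toNNReal (1 / (1 - r * γ)) + Real.toNNReal (1 / (1 - p * γ))),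
    fun f g hf hg => ?_⟩
  have := lintegral_lintegral_kernel_mul_le (μ := volume) (ν := volume)
    (K := fun x x' : EuclideanSpace ℝ (Fin n) =>
      ENNReal.ofReal (‖x - x'‖ ^ (-((n : ℝ) * (1 - γ)))))
    (by unfold Function.uncurry; fun_prop)
    (fun a E _ => hA' a E)
    (fun a E _ => by simp_rw [norm_sub_rev a]; exact hA' a E)
    (by simp) hf hg hγ hp hr hpr
  simpa [ENNReal.ofReal] using this

/-- After Tonelli, the shifted-kernel inequality is applied in (t, t') for fixed x ≠ x', then the
Riesz inequality in (x, x') to the slice norms F and G. The norms of F in L^p and G in L^r are the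
full norms of f and g. -/
theorem exists_extendedConeKernel_bilinear_le (hα : 0 < α) (hαn : α < n) (hp : 1 < p)
    (hr : 1 < r) (hpr : 1 / p + 1 / r = 1 + α / n) :
    ∃ B : ℝ≥0, ∀ (f g : SpaceTime n → ℝ≥0∞), Measurable f → Measurable g →
      ∫⁻ z, ∫⁻ z', extendedConeKernel n α (z - z') * (f z' * g z) ≤
        B * ((∫⁻ z, f z ^ p) ^ (1 / p) * (∫⁻ z, g z ^ r) ^ (1 / r)) := by
  have hn' : (0 : ℝ) < n := hα.trans hαn
  have hn : 0 < n := by exact_mod_cast hn'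
  have hγ : 0 < α / n := by positivity
  have hγ1 : α / n < 1 := by rwa [div_lt_one hn']
  have hp0 : 0 < p := by linarith
  have hr0 : 0 < r := by linarith
  have : NeZero n := ⟨hn.ne'⟩
  obtain ⟨B₁, hB₁⟩ := exists_shiftedKernel_bilinear_le hγ hγ1 hp hr hpr
  obtain ⟨B₂, hB₂⟩ := exists_riesz_bilinear_le hn hγ hγ1 hp hr hpr
  refine ⟨B₁ * B₂, fun f g hf hg => ?_⟩
  set F : EuclideanSpace ℝ (Fin n) → ℝ≥0∞ := fun x => (∫⁻ t, f (x, t) ^ p) ^ (1 / p) with hF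
  set G : EuclideanSpace ℝ (Fin n) → ℝ≥0∞ := fun x => (∫⁻ t, g (x, t) ^ r) ^ (1 / r) with hG
  have hFm : Measurable F := (hf.pow_const p).lintegral_prod_right'.pow_const _
  have hGm : Measurable G := (hg.pow_const r).lintegral_prod_right'.pow_const _
  have hFp : ∫⁻ x, F x ^ p = ∫⁻ z, f z ^ p := by
    rw [Measure.volume_eq_prod, lintegral_prod _ (hf.pow_const p).aemeasurable]
    refine lintegral_congr fun x => ?_
    rw [hF, ← ENNReal.rpow_mul, one_div_mul_cancel hp0.ne', ENNReal.rpow_one]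
  have hGr : ∫⁻ x, G x ^ r = ∫⁻ z, g z ^ r := by
    rw [Measure.volume_eq_prod, lintegral_prod _ (hg.pow_const r).aemeasurable]
    refine lintegral_congr fun x => ?_
    rw [hG, ← ENNReal.rpow_mul, one_div_mul_cancel hr0.ne', ENNReal.rpow_one]
  set Φ : SpaceTime n → SpaceTime n → ℝ≥0∞ :=
    fun z z' => extendedConeKernel n α (z - z') * (f z' * g z) with hΦ
  have hΦm : Measurable fun u : SpaceTime n × SpaceTime n => Φ u.1 u.2 :=
    ((measurable_extendedConeKernel n α).comp (measurable_fst.sub measurable_snd)).mul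
      ((hf.comp measurable_snd).mul (hg.comp measurable_fst))
  have hslice : ∀ x x', x' ≠ x → ∫⁻ t, ∫⁻ t', Φ (x, t) (x', t') ≤
      B₁ * (ENNReal.ofReal (‖x - x'‖ ^ (-((n : ℝ) * (1 - α / n)))) * (F x' * G x)) := by
    intro x x' hx
    set a := ENNReal.ofReal (‖x - x'‖ ^ (-((n : ℝ) * (1 - α / n))))
    calc ∫⁻ t, ∫⁻ t', Φ (x, t) (x', t')
        ≤ ∫⁻ t, ∫⁻ t', a * (ENNReal.ofReal (shiftedKernel (α / n) ‖x - x'‖ (t - t')) *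
            (f (x', t') * g (x, t))) := by
          refine lintegral_mono fun t => lintegral_mono fun t' => ?_
          simp only [hΦ]
          rw [← mul_assoc a]
          gcongr
          exact extendedConeKernel_le hn hαn (w := (x, t) - (x', t')) (sub_ne_zero.2 hx.symm)
      _ = a * ∫⁻ t, ∫⁻ t', ENNReal.ofReal (shiftedKernel (α / n) ‖x - x'‖ (t - t')) *
            (f (x', t') * g (x, t)) := by
          simp_rw [lintegral_const_mul' a _ ENNReal.ofReal_ne_top]
      _ ≤ a * (B₁ * (F x' * G x)) := by
          gcongr
          exact hB₁ ‖x - x'‖ (fun t => f (x', t)) (fun t => g (x, t))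
            (hf.comp measurable_prodMk_left) (hg.comp measurable_prodMk_left)
      _ = _ := by ring
  calc ∫⁻ z, ∫⁻ z', Φ z z'
      = ∫⁻ x, ∫⁻ t, ∫⁻ x', ∫⁻ t', Φ (x, t) (x', t') := by
        rw [Measure.volume_eq_prod, lintegral_prod _ hΦm.lintegral_prod_right'.aemeasurable]
        refine lintegral_congr fun x => lintegral_congr fun t => ?_
        exact lintegral_prod _ (hΦm.comp measurable_prodMk_left).aemeasurable
    _ = ∫⁻ x, ∫⁻ x', ∫⁻ t, ∫⁻ t', Φ (x, t) (x', t') := by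
        refine lintegral_congr fun x => lintegral_lintegral_swap ?_
        have : Measurable fun u : (ℝ × EuclideanSpace ℝ (Fin n)) × ℝ =>
            Φ (x, u.1.1) (u.1.2, u.2) :=
          hΦm.comp (f := fun u : (ℝ × EuclideanSpace ℝ (Fin n)) × ℝ =>
            (((x, u.1.1) : SpaceTime n), ((u.1.2, u.2) : SpaceTime n))) (by fun_prop)
        exact this.lintegral_prod_right'.aemeasurable
    _ ≤ ∫⁻ x, ∫⁻ x', B₁ * (ENNReal.ofReal (‖x - x'‖ ^ (-((n : ℝ) * (1 - α / n)))) *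
          (F x' * G x)) := by
        refine lintegral_mono fun x => lintegral_mono_ae ?_
        -- The excluded slice x' = x is null because n ≥ 1.
        filter_upwards [Measure.ae_ne volume x] with x' hx'
        exact hslice x x' hx'
    _ = B₁ * ∫⁻ x, ∫⁻ x', ENNReal.ofReal (‖x - x'‖ ^ (-((n : ℝ) * (1 - α / n)))) *
          (F x' * G x) := by
        simp_rw [lintegral_const_mul' _ _ ENNReal.coe_ne_top]
    _ ≤ B₁ * (B₂ * ((∫⁻ x, F x ^ p) ^ (1 / p) * (∫⁻ x, G x ^ r) ^ (1 / r))) := by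
        gcongr
        exact hB₂ F G hFm hGm
    _ = _ := by rw [hFp, hGr, ENNReal.coe_mul, mul_assoc]

theorem exists_extendedConeKernel_conv_le (hα : 0 < α) (hαn : α < n) (hp : 1 < p) (hpq : p < q)
    (hpqα : α / n = 1 / p - 1 / q) :
    ∃ B : ℝ≥0, ∀ f : SpaceTime n → ℝ≥0∞, Measurable f →
      (∫⁻ z, (∫⁻ w, f (z - w) * extendedConeKernel n α w) ^ q) ^ (1 / q) ≤
        B * (∫⁻ z, f z ^ p) ^ (1 / p) := by
  have hqr := Real.HolderConjugate.conjExponent (hp.trans hpq)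
  set r := q.conjExponent
  have hpr : 1 / p + 1 / r = 1 + α / n := by
    have := hqr.inv_add_inv_eq_one
    rw [hpqα]; simp only [one_div]; linarith
  obtain ⟨B, hB⟩ := exists_extendedConeKernel_bilinear_le hα hαn hp hqr.symm.lt hpr
  have := isAddHaarMeasure_volume_spaceTime n
  refine ⟨B, fun f hf => ?_⟩
  have hk := measurable_extendedConeKernel n α
  have hm : Measurable fun u : SpaceTime n × SpaceTime n =>
      f (u.1 - u.2) * extendedConeKernel n α u.2 :=
    (hf.comp (measurable_fst.sub measurable_snd)).mul (hk.comp measurable_snd)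
  refine lintegral_rpow_le_of_forall_lintegral_mul_le hm.lintegral_prod_right' hqr
    fun g hg => ?_
  calc ∫⁻ z, (∫⁻ w, f (z - w) * extendedConeKernel n α w) * g z
      = ∫⁻ z, ∫⁻ z', extendedConeKernel n α (z - z') * (f z' * g z) := by
        refine lintegral_congr fun z => ?_
        have h1 : Measurable fun w => f (z - w) * extendedConeKernel n α w :=
          hm.comp measurable_prodMk_left
        rw [← lintegral_sub_left_eq_self
          (fun z' => extendedConeKernel n α (z - z') * (f z' * g z)) z,
          ← lintegral_mul_const _ h1]
        refine lintegral_congr fun w => ?_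
        rw [sub_sub_cancel]; ring
    _ ≤ _ := (hB f g hf hg).trans_eq (by ring)

end Cone

/-! ### The operator on L^p: sufficiency. -/

section Operator

variable {𝕜 : Type*} [RCLike 𝕜] {n : ℕ} {α p q : ℝ}

theorem enorm_coneIntegrand (f : SpaceTime n → 𝕜) (z : SpaceTime n) {w : SpaceTime n}
    (hw : w ∈ coneRegion n) :
    ‖coneIntegrand n α f z w‖ₑ = ‖f (z - w)‖ₑ * ENNReal.ofReal (coneKernel n α w) := by
  rw [coneIntegrand, enorm_mul, ← ofReal_norm ((coneKernel n α w : ℝ) : 𝕜),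
    RCLike.norm_ofReal, abs_of_nonneg (coneKernel_nonneg hw)]
  rfl

theorem setLIntegral_enorm_coneIntegrand (f : SpaceTime n → 𝕜) (z : SpaceTime n) :
    ∫⁻ w in coneRegion n, ‖coneIntegrand n α f z w‖ₑ =
      ∫⁻ w, ‖f (z - w)‖ₑ * extendedConeKernel n α w := by
  rw [← lintegral_indicator (isOpen_coneRegion n).measurableSet]
  refine lintegral_congr fun w => ?_
  by_cases hw : w ∈ coneRegion n
  · rw [Set.indicator_of_mem hw, enorm_coneIntegrand f z hw, extendedConeKernel,
      Set.indicator_of_mem hw]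
  · rw [Set.indicator_of_notMem hw, extendedConeKernel, Set.indicator_of_notMem hw, mul_zero]

theorem coneIntegrand_ae_eq {f g : SpaceTime n → 𝕜} (h : f =ᵐ[volume] g) (z : SpaceTime n) :
    coneIntegrand n α f z =ᵐ[volume] coneIntegrand n α g z := by
  have := isAddHaarMeasure_volume_spaceTime n
  have hz : ∀ᵐ w : SpaceTime n, f (z - w) = g (z - w) :=
    (quasiMeasurePreserving_sub_left volume z).ae h
  filter_upwards [hz] with w hw
  change f (z - w) * _ = g (z - w) * _
  rw [hw]

theorem stronglyMeasurable_uncurry_coneIntegrand {f : SpaceTime n → 𝕜}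
    (hf : StronglyMeasurable f) :
    StronglyMeasurable (Function.uncurry (coneIntegrand n α f)) := by
  refine StronglyMeasurable.mul
    (hf.comp_measurable (g := fun u : SpaceTime n × SpaceTime n => u.1 - u.2) (by fun_prop)) ?_
  exact (RCLike.continuous_ofReal.comp_stronglyMeasurable
    (measurable_coneKernel n α).stronglyMeasurable).comp_measurable measurable_snd

theorem coneFracIntBounded_of_eq (hα : 0 < α) (hαn : α < n) (hp : 1 < p) (hpq : p < q)
    (h : α / n = 1 / p - 1 / q) :
    ConeFracIntBounded 𝕜 n α (ENNReal.ofReal p) (ENNReal.ofReal q) := by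
  have hp0 : 0 < p := by linarith
  have hq0 : 0 < q := by linarith
  obtain ⟨B, hB⟩ := exists_extendedConeKernel_conv_le hα hαn hp hpq h
  refine ⟨B, fun f hf => ?_⟩
  -- Passing to a strongly measurable representative changes the integrand only on a null set for
  -- every z, so the fractional integral is unchanged everywhere.
  obtain ⟨g, hg, hfg⟩ := hf.1
  have hint : ∀ z, coneIntegrand n α f z =ᵐ[volume.restrict (coneRegion n)]
      coneIntegrand n α g z := fun z => ae_restrict_of_ae (coneIntegrand_ae_eq hfg z)
  have hfrac : coneFracInt n α f = coneFracInt n α g :=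
    funext fun z => integral_congr_ae (hint z)
  have hgm := stronglyMeasurable_uncurry_coneIntegrand (α := α) hg
  have hnorm : ∀ {s : ℝ} (_ : 0 < s) (u : SpaceTime n → 𝕜),
      eLpNorm u (ENNReal.ofReal s) volume = (∫⁻ z, ‖u z‖ₑ ^ s) ^ (1 / s) := by
    intro s hs u
    rw [eLpNorm_eq_lintegral_rpow_enorm_toReal (by simpa using hs) ENNReal.ofReal_ne_top,
      ENNReal.toReal_ofReal hs.le]
  set T : SpaceTime n → ℝ≥0∞ := fun z => ∫⁻ w in coneRegion n, ‖coneIntegrand n α g z w‖ₑ with hT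
  have hTm : Measurable T := hgm.enorm.lintegral_prod_right'
  have hTq : (∫⁻ z, T z ^ q) ^ (1 / q) ≤ B * eLpNorm f (ENNReal.ofReal p) volume := by
    rw [eLpNorm_congr_ae hfg, hnorm hp0]
    simp_rw [hT, setLIntegral_enorm_coneIntegrand]
    exact hB (fun z => ‖g z‖ₑ) hg.enorm
  have hle : eLpNorm (coneFracInt n α g) (ENNReal.ofReal q) volume ≤
      B * eLpNorm f (ENNReal.ofReal p) volume := by
    refine le_trans ?_ hTq
    rw [hnorm hq0]
    gcongr with z
    exact enorm_integral_le_lintegral_enorm _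
  have htop : (B : ℝ≥0∞) * eLpNorm f (ENNReal.ofReal p) volume < ∞ :=
    ENNReal.mul_lt_top ENNReal.coe_lt_top hf.2
  refine ⟨?_, ⟨?_, ?_⟩, ?_⟩
  · have hTlt : ∫⁻ z, T z ^ q < ∞ :=
      (ENNReal.rpow_lt_top_iff_of_pos (by positivity)).1 (hTq.trans_lt htop)
    filter_upwards [ae_lt_top (hTm.pow_const q) hTlt.ne] with z hz
    refine Integrable.congr ⟨?_, ?_⟩ (hint z).symm
    · exact (hgm.comp_measurable measurable_prodMk_left).aestronglyMeasurable
    · exact (ENNReal.rpow_lt_top_iff_of_pos hq0).1 hz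
  · rw [hfrac]
    exact (StronglyMeasurable.integral_prod_right' hgm).aestronglyMeasurable
  · rw [hfrac]; exact hle.trans_lt htop
  · rw [hfrac]; exact hle

/-! ### Necessity by scaling. -/

/-- A nonnegative f produces no cancellation. Integrability is required because the Bochner integral
of a nonintegrable function is 0 by convention. -/
theorem enorm_coneFracInt_of_nonneg {f : SpaceTime n → ℝ} (hf : ∀ z, 0 ≤ f z) {z : SpaceTime n}
    (hi : IntegrableOn (coneIntegrand n α (fun z => (f z : 𝕜)) z) (coneRegion n) volume) :
    ‖coneFracInt n α (fun z => (f z : 𝕜)) z‖ₑ =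
      ∫⁻ w in coneRegion n, ‖coneIntegrand n α (fun z => (f z : 𝕜)) z w‖ₑ := by
  have h1 : coneFracInt n α (fun z => (f z : 𝕜)) z =
      ((∫ w in coneRegion n, ‖coneIntegrand n α (fun z => (f z : 𝕜)) z w‖ : ℝ) : 𝕜) := by
    rw [coneFracInt, ← integral_ofReal]
    refine setIntegral_congr_fun (isOpen_coneRegion n).measurableSet fun w hw => ?_
    simp only [coneIntegrand]
    rw [← RCLike.ofReal_mul, RCLike.norm_ofReal,
      abs_of_nonneg (mul_nonneg (hf _) (coneKernel_nonneg hw))]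
  rw [h1, ← ofReal_integral_norm_eq_lintegral_enorm hi, ← ofReal_norm,
    RCLike.norm_ofReal, abs_of_nonneg (integral_nonneg fun _ => norm_nonneg _)]

/-- Supplies a ball of radius proportional to R inside the cone on which the kernel is bounded
below. In the sup norm of the product, its points satisfy |y| < R/4 < s < 3R/4. -/
theorem mem_coneRegion_of_mem_ball {R : ℝ} {w : SpaceTime n}
    (hw : w ∈ Metric.ball ((0, R / 2) : SpaceTime n) (R / 4)) :
    w ∈ coneRegion n ∧ w ∈ Metric.ball (0 : SpaceTime n) R := by
  rw [← ball_prod_same, Set.mem_prod, mem_ball_zero_iff, Real.ball_eq_Ioo] at hw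
  obtain ⟨h1, h2, h3⟩ := hw
  have hR : 0 < R := by linarith [norm_nonneg w.1]
  have h4 : |w.2| = w.2 := abs_of_pos (by linarith)
  constructor
  · show ‖w.1‖ < |w.2|
    rw [h4]; linarith
  · rw [mem_ball_zero_iff, Prod.norm_def, max_lt_iff, Real.norm_eq_abs, h4]
    constructor <;> linarith

/-- Both |s| + |y| and |s| - |y| are at most 2R and carry nonpositive powers, whose exponents add up
by (n - α) + (1 - α/n) = (n + 1)(1 - α/n). -/
theorem le_coneKernel (hα : 0 < α) (hαn : α < n) {R : ℝ} {w : SpaceTime n}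
    (hw : w ∈ coneRegion n) (hwR : w ∈ Metric.ball (0 : SpaceTime n) R) :
    (2 * R) ^ (-((n + 1 : ℝ) * (1 - α / n))) ≤ coneKernel n α w := by
  have hn : (0 : ℝ) < n := hα.trans hαn
  have h : ‖w.1‖ < |w.2| := hw
  have hpos : 0 < |w.2| - ‖w.1‖ := sub_pos.2 h
  rw [mem_ball_zero_iff, Prod.norm_def, max_lt_iff, Real.norm_eq_abs] at hwR
  have hy := norm_nonneg w.1
  have hR : 0 < 2 * R := by linarith
  have hγ : 0 < 1 - α / n := by rw [sub_pos, div_lt_one hn]; exact hαn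
  rw [coneKernel, one_div, one_div, Real.inv_rpow (by positivity),
    Real.inv_rpow hpos.le, ← Real.rpow_neg (by positivity), ← Real.rpow_neg hpos.le,
    show -((n + 1 : ℝ) * (1 - α / n)) = -(n - α) + -(1 - α / n) by field_simp; ring,
    Real.rpow_add hR]
  gcongr ?_ * ?_
  · exact Real.rpow_le_rpow_of_nonpos (by linarith) (by linarith) (by linarith)
  · exact Real.rpow_le_rpow_of_nonpos hpos (by linarith) (by linarith)

/-- The lower bound for `I_α` applied to the indicator of a ball, on the concentric ball with
half the radius. -/
theorem le_enorm_coneFracInt_indicator_ball (hα : 0 < α) (hαn : α < n) {R : ℝ} {z : SpaceTime n}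
    (hz : z ∈ Metric.ball (0 : SpaceTime n) R)
    (hi : IntegrableOn (coneIntegrand n α
      (fun z => (((Metric.ball (0 : SpaceTime n) (2 * R)).indicator 1 z : ℝ) : 𝕜)) z)
      (coneRegion n) volume) :
    ENNReal.ofReal ((2 * R) ^ (-((n + 1 : ℝ) * (1 - α / n)))) *
        volume (Metric.ball ((0, R / 2) : SpaceTime n) (R / 4)) ≤
      ‖coneFracInt n α
        (fun z => (((Metric.ball (0 : SpaceTime n) (2 * R)).indicator 1 z : ℝ) : 𝕜)) z‖ₑ := by
  have h0 : ∀ z, 0 ≤ (Metric.ball (0 : SpaceTime n) (2 * R)).indicator (1 : SpaceTime n → ℝ) z :=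
    Set.indicator_nonneg fun _ _ => zero_le_one
  rw [enorm_coneFracInt_of_nonneg h0 hi,
    ← setLIntegral_const]
  calc ∫⁻ _ in Metric.ball ((0, R / 2) : SpaceTime n) (R / 4),
        ENNReal.ofReal ((2 * R) ^ (-((n + 1 : ℝ) * (1 - α / n))))
      ≤ ∫⁻ w in Metric.ball ((0, R / 2) : SpaceTime n) (R / 4), ‖coneIntegrand n α
          (fun z => (((Metric.ball (0 : SpaceTime n) (2 * R)).indicator 1 z : ℝ) : 𝕜)) z w‖ₑ := by
        refine setLIntegral_mono' measurableSet_ball fun w hw => ?_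
        obtain ⟨h1, h2⟩ := mem_coneRegion_of_mem_ball hw
        have h3 : z - w ∈ Metric.ball (0 : SpaceTime n) (2 * R) := by
          rw [mem_ball_zero_iff] at *
          linarith [norm_sub_le z w]
        rw [enorm_coneIntegrand _ _ h1, Set.indicator_of_mem h3]
        simpa using ENNReal.ofReal_le_ofReal (le_coneKernel hα hαn h1 h2)
    _ ≤ _ := lintegral_mono_set fun w hw => (mem_coneRegion_of_mem_ball hw).1

theorem eq_of_coneFracIntBounded (hα : 0 < α) (hαn : α < n) (hp : 1 < p) (hpq : p < q)
    (h : ConeFracIntBounded 𝕜 n α (ENNReal.ofReal p) (ENNReal.ofReal q)) :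
    α / n = 1 / p - 1 / q := by
  have hp0 : 0 < p := by linarith
  have hq0 : 0 < q := by linarith
  have := isAddHaarMeasure_volume_spaceTime n
  obtain ⟨C, hC⟩ := h
  set v := (volume (Metric.ball (0 : SpaceTime n) 1)).toReal with hv
  have hv0 : 0 < v := ENNReal.toReal_pos (Metric.measure_ball_pos _ _ one_pos).ne'
    measure_ball_lt_top.ne
  have hvol : ∀ (c : SpaceTime n) {R : ℝ}, 0 < R →
      volume (Metric.ball c R) = ENNReal.ofReal (R ^ (n + 1 : ℝ) * v) := by
    intro c R hR
    rw [Measure.addHaar_ball_of_pos _ _ hR, ENNReal.ofReal_mul (by positivity), hv,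
      ENNReal.ofReal_toReal measure_ball_lt_top.ne]
    congr 2
    rw [← Real.rpow_natCast]
    congr 1
    simp
  set d : ℝ := n + 1 with hd
  have hd0 : 0 < d := by positivity
  -- The indicator of the ball of radius 2R is the test function. Its fractional integral is at
  -- least L almost everywhere on the ball of radius R, which bounds the L^q norm from below.
  have hineq : ∀ R : ℝ, 0 < R →
      (2 * R) ^ (-(d * (1 - α / n))) * ((R / 4) ^ d * v) * (R ^ d * v) ^ (1 / q) ≤
        C * ((2 * R) ^ d * v) ^ (1 / p) := by
    intro R hR
    set f : SpaceTime n → 𝕜 :=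
      fun z => (((Metric.ball (0 : SpaceTime n) (2 * R)).indicator 1 z : ℝ) : 𝕜) with hf
    have hf' : f = (Metric.ball (0 : SpaceTime n) (2 * R)).indicator fun _ => (1 : 𝕜) := by
      ext z
      by_cases hz : z ∈ Metric.ball (0 : SpaceTime n) (2 * R)
      · simp only [hf, Set.indicator_of_mem hz]; simp
      · simp only [hf, Set.indicator_of_notMem hz]; simp
    have hfL : MemLp f (ENNReal.ofReal p) volume := by
      rw [hf']
      exact memLp_indicator_const _ measurableSet_ball _ (Or.inr measure_ball_lt_top.ne)
    obtain ⟨h1, -, h3⟩ := hC f hfL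
    have hn1 : eLpNorm f (ENNReal.ofReal p) volume =
        ENNReal.ofReal (((2 * R) ^ d * v) ^ (1 / p)) := by
      rw [hf', eLpNorm_indicator_const measurableSet_ball (by simpa using hp0)
        ENNReal.ofReal_ne_top, hvol _ (by positivity), ENNReal.toReal_ofReal hp0.le,
        ENNReal.ofReal_rpow_of_pos (by positivity)]
      simp
    set L : ℝ := (2 * R) ^ (-(d * (1 - α / n))) * ((R / 4) ^ d * v) with hL
    have hL0 : 0 < L := by positivity
    have hn2 : ENNReal.ofReal (L * (R ^ d * v) ^ (1 / q)) ≤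
        eLpNorm (coneFracInt n α f) (ENNReal.ofReal q) volume := by
      have h4 : eLpNorm ((Metric.ball (0 : SpaceTime n) R).indicator fun _ => L)
          (ENNReal.ofReal q) volume = ENNReal.ofReal (L * (R ^ d * v) ^ (1 / q)) := by
        rw [eLpNorm_indicator_const measurableSet_ball (by simpa using hq0)
          ENNReal.ofReal_ne_top, hvol _ hR, ENNReal.toReal_ofReal hq0.le,
          ENNReal.ofReal_rpow_of_pos (by positivity), ENNReal.ofReal_mul hL0.le,
          Real.enorm_eq_ofReal hL0.le]
      rw [← h4]
      refine eLpNorm_mono_enorm_ae ?_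
      filter_upwards [h1] with z hz
      by_cases hzR : z ∈ Metric.ball (0 : SpaceTime n) R
      · rw [Set.indicator_of_mem hzR, Real.enorm_eq_ofReal hL0.le, hL,
          ENNReal.ofReal_mul (by positivity),
          ← hvol ((0, R / 2) : SpaceTime n) (by positivity)]
        exact le_enorm_coneFracInt_indicator_ball hα hαn hzR hz
      · rw [Set.indicator_of_notMem hzR]; simp
    have h5 := hn2.trans h3
    rw [hn1, ← ENNReal.ofReal_coe_nnreal, ← ENNReal.ofReal_mul C.coe_nonneg] at h5
    exact (ENNReal.ofReal_le_ofReal_iff (by positivity)).1 h5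
  clear_value d
  by_contra hne
  -- The net power of R in the inequality: -d(1 - α/n) + d + d/q on the left against d/p on the
  -- right.
  set e : ℝ := d * (α / n + 1 / q - 1 / p) with he
  have he0 : e ≠ 0 := mul_ne_zero hd0.ne' fun h0 => hne (by linarith)
  set c : ℝ := 2 ^ (-(d * (1 - α / n))) * ((1 / 4) ^ d * v) * v ^ (1 / q) with hc
  have hc0 : 0 < c := by positivity
  set c' : ℝ := C * (2 ^ d * v) ^ (1 / p) with hc'
  have hc'0 : 0 ≤ c' := by positivity
  have hbd : ∀ R : ℝ, 0 < R → c * R ^ e ≤ c' := by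
    intro R hR
    have h1 := hineq R hR
    have e1 : (2 * R) ^ (-(d * (1 - α / n))) * ((R / 4) ^ d * v) * (R ^ d * v) ^ (1 / q) =
        c * R ^ e * R ^ (d * (1 / p)) := by
      rw [Real.mul_rpow two_pos.le hR.le, div_eq_mul_one_div R 4,
        Real.mul_rpow hR.le (by norm_num), Real.mul_rpow (by positivity) hv0.le,
        ← Real.rpow_mul hR.le, hc, mul_assoc _ (R ^ e), ← Real.rpow_add hR,
        show e + d * (1 / p) = -(d * (1 - α / n)) + d + d * (1 / q) by rw [he]; ring,
        Real.rpow_add hR, Real.rpow_add hR]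
      ring
    have e2 : C * ((2 * R) ^ d * v) ^ (1 / p) = c' * R ^ (d * (1 / p)) := by
      rw [show (2 * R) ^ d * v = 2 ^ d * v * R ^ d by rw [Real.mul_rpow two_pos.le hR.le]; ring,
        Real.mul_rpow (by positivity) (by positivity), ← Real.rpow_mul hR.le, hc', mul_assoc]
    rw [e1, e2] at h1
    exact le_of_mul_le_mul_right h1 (by positivity)
  -- For this R one has c R^e = c' + c > c', whichever the sign of e.
  have h2 := hbd ((c' / c + 1) ^ (1 / e)) (by positivity)
  rw [← Real.rpow_mul (by positivity), one_div_mul_cancel he0, Real.rpow_one, mul_add,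
    mul_div_cancel₀ _ hc0.ne'] at h2
  linarith

end Operator

theorem theoremA (𝕜 : Type*) [RCLike 𝕜] (n : ℕ) (α : ℝ) (hα : 0 < α) (hαn : α < (n : ℝ))
    (p q : ℝ) (hp : 1 < p) (hpq : p < q) :
    ConeFracIntBounded 𝕜 n α (ENNReal.ofReal p) (ENNReal.ofReal q) ↔
      α / (n : ℝ) = 1 / p - 1 / q :=
  ⟨eq_of_coneFracIntBounded hα hαn hp hpq, coneFracIntBounded_of_eq hα hαn hp hpq⟩
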